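/- Let $G$ be a finite simple graph that is connected and bipartite, with vertices $v_1,\dots,v_n$, and let $\Phi=(G,\varphi)$ be a $\mathbb{T}$-gain graph on $G$: $\varphi$ assigns to each orientation $\overrightarrow{e_{i,j}}$ of each edge $v_iv_j$ of $G$ a complex number of modulus $1$, with $\varphi(\overrightarrow{e_{i,j}})=\varphi(\overrightarrow{e_{j,i}})^{-1}$. Let $A(\Phi)$ be the Hermitian $n\times n$ matrix with $(i,j)$ entry $\varphi(\overrightarrow{e_{i,j}})$ if $v_i$ and $v_j$ are adjacent and $0$ otherwise. Call $\Phi$ balanced if, for every oriented cycle of $G$, the product of the gains $\varphi$ of its oriented edges is $1$. Then the following are equivalent: 1. $A(\Phi)$ has exactly one positive eigenvalue, counted with multiplicity; 2. $G$ is a complete bipartite graph $K_{p,q}$ for some $p,q\ge 1$, and $\Phi$ is balanced; 3. $G$ is a complete bipartite graph $K_{p,q}$ for some $p,q\ge 1$, and $\Phi$ is switching equivalent to $(G,1)$, the gain graph on $G$ with all gains $1$; that is, $A((G,1))=UA(\Phi)U^{*}$ for some unitary diagonal matrix $U$. -/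

import Mathlib

/-- A `𝕋`-gain graph with underlying simple graph `G`: every oriented edge (dart) of `G` carries a
unit complex number, and reversing the orientation inverts it. -/
structure TGainGraph {V : Type*} (G : SimpleGraph V) where
  gain : G.Dart → Circle
  gain_symm : ∀ d : G.Dart, gain d.symm = (gain d)⁻¹

namespace TGainGraph

variable {V : Type*} {G : SimpleGraph V}

/-- The gain graph `(G, 1)`, all of whose gains are `1`. -/
noncomputable def allOne (G : SimpleGraph V) : TGainGraph G where
  gain := fun _ => 1
  gain_symm := fun _ => inv_one.symm

open Classical in
/-- The adjacency matrix `A(Φ)`. -/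
noncomputable def adjMatrix (Φ : TGainGraph G) : Matrix V V ℂ :=
  Matrix.of fun u v => if h : G.Adj u v then (Φ.gain ⟨(u, v), h⟩ : ℂ) else 0

theorem adjMatrix_isHermitian (Φ : TGainGraph G) : Φ.adjMatrix.IsHermitian := by
  ext u v
  by_cases h : G.Adj u v
  · have h2 : Φ.gain ⟨(v, u), h.symm⟩ = (Φ.gain ⟨(u, v), h⟩)⁻¹ := Φ.gain_symm ⟨(u, v), h⟩
    rw [Matrix.conjTranspose_apply]
    simp only [adjMatrix, Matrix.of_apply, h, h.symm, dif_pos, h2, Circle.coe_inv_eq_conj]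
    simp
  · have h2 : ¬ G.Adj v u := fun k => h k.symm
    simp [adjMatrix, Matrix.conjTranspose_apply, h, h2]

/-- The number of positive eigenvalues of `A(Φ)`, counted with multiplicity (the family
`Matrix.IsHermitian.eigenvalues`, indexed by the vertices, repeats eigenvalues accordingly). -/
noncomputable def numPosEigenvalues [Fintype V] [DecidableEq V] (Φ : TGainGraph G) : ℕ :=
  (Finset.univ.filter fun i : V => 0 < Φ.adjMatrix_isHermitian.eigenvalues i).card

/-- The gain of a walk: the product of the gains of the oriented edges it traverses. -/
noncomputable def walkGain (Φ : TGainGraph G) {u v : V} (p : G.Walk u v) : Circle :=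
  (p.darts.map Φ.gain).prod

/-- `Φ` is balanced: every oriented cycle has gain `1`. -/
def IsBalanced (Φ : TGainGraph G) : Prop :=
  ∀ (v : V) (c : G.Walk v v), c.IsCycle → Φ.walkGain c = 1

/-- Switching equivalence: `A(Φ') = U A(Φ) U*` for some unitary diagonal matrix `U`. -/
def SwitchingEquivalent [Fintype V] [DecidableEq V] (Φ Φ' : TGainGraph G) : Prop :=
  ∃ d : V → ℂ, Matrix.diagonal d ∈ Matrix.unitaryGroup V ℂ ∧
    Φ'.adjMatrix = Matrix.diagonal d * Φ.adjMatrix * (Matrix.diagonal d).conjTranspose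

end TGainGraph

/-- `G` is a complete bipartite graph `K_{p,q}`, with both parts nonempty. -/
def SimpleGraph.IsCompleteBipartiteGraph {V : Type*} (G : SimpleGraph V) : Prop :=
  ∃ p q : ℕ, 1 ≤ p ∧ 1 ≤ q ∧ Nonempty (G ≃g completeBipartiteGraph (Fin p) (Fin q))

/-! Ordering the vertices by side puts `A(Φ)` in the form `[[0, B], [Bᴴ, 0]]`, so everything turns
on whether `B` has rank one, expressed as the vanishing of its `2 × 2` minors (`BlockMinorsVanish`).
For `w` on one side, the form at `w + A w` is `2 ‖A w‖²`. If only one eigenvalue is positive, some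
nontrivial combination of any two such test vectors has nonpositive form, hence `A w = 0`: any two
columns of `B` are dependent. Vanishing minors force completeness, because `B` has no zero row or
column when `G` is connected with an edge. They also factor the gains as `star (d u) * d v`, which
is switching equivalence to `(G, 1)`. Conversely, for such gains on a complete bipartite graph the
form is nonpositive on the hyperplane `d ⬝ᵥ z = 0`, while trace zero and an edge give at least one
positive eigenvalue. Balance enters through 4-cycles, whose gain condition is exactly a vanishing
minor; the factored gains telescope around closed walks. -/

open scoped Matrix in
/-- In the eigenbasis coordinates of `z`, the Hermitian form is a real diagonal form. -/
theorem Matrix.IsHermitian.re_dotProduct_mulVec_eq_sum {n : Type*} [Fintype n] [DecidableEq n]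
    {A : Matrix n n ℂ} (hA : A.IsHermitian) (z : n → ℂ) :
    (star z ⬝ᵥ (A *ᵥ z)).re =
      ∑ i, hA.eigenvalues i *
        Complex.normSq ((star (hA.eigenvectorUnitary : Matrix n n ℂ) *ᵥ z) i) := by
  set U : Matrix n n ℂ := hA.eigenvectorUnitary.1 with hU
  have hspec : A = U * Matrix.diagonal (RCLike.ofReal ∘ hA.eigenvalues) * star U := by
    conv_lhs => rw [hA.spectral_theorem, Unitary.conjStarAlgAut_apply]
  have h1 : star z ⬝ᵥ (A *ᵥ z) = star (star U *ᵥ z) ⬝ᵥ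
      (Matrix.diagonal (RCLike.ofReal ∘ hA.eigenvalues) *ᵥ (star U *ᵥ z)) := by
    conv_lhs => rw [hspec]
    rw [Matrix.star_mulVec, Matrix.star_eq_conjTranspose, Matrix.conjTranspose_conjTranspose,
      ← Matrix.dotProduct_mulVec, Matrix.mulVec_mulVec, Matrix.mulVec_mulVec, Matrix.mul_assoc]
  rw [h1, dotProduct, Complex.re_sum]
  refine Finset.sum_congr rfl fun i _ => ?_
  rw [Matrix.mulVec_diagonal]
  simp [Complex.normSq_apply]
  ring

open scoped Matrix in
/-- A Hermitian form that is nonpositive on a hyperplane has at most one positive eigenvalue. -/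
theorem Matrix.IsHermitian.card_pos_eigenvalues_le_one {n : Type*} [Fintype n] [DecidableEq n]
    {A : Matrix n n ℂ} (hA : A.IsHermitian) (x : n → ℂ)
    (hx : ∀ z : n → ℂ, x ⬝ᵥ z = 0 → (star z ⬝ᵥ (A *ᵥ z)).re ≤ 0) :
    (Finset.univ.filter fun i => 0 < hA.eigenvalues i).card ≤ 1 := by
  rw [Finset.card_le_one]
  intro i hi j hj
  simp only [Finset.mem_filter, Finset.mem_univ, true_and] at hi hj
  by_contra hij
  set U : Matrix n n ℂ := hA.eigenvectorUnitary.1 with hU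
  have hUU : star U * U = 1 := Unitary.coe_star_mul_self hA.eigenvectorUnitary
  -- The plane spanned by two eigenvectors with positive eigenvalues meets the hyperplane
  -- nontrivially.
  obtain ⟨a, b, hab, h0⟩ : ∃ a b : ℂ, (a ≠ 0 ∨ b ≠ 0) ∧
      a * (x ᵥ* U) i + b * (x ᵥ* U) j = 0 := by
    by_cases h : (x ᵥ* U) i = 0
    · exact ⟨1, 0, by simp, by simp [h]⟩
    · exact ⟨(x ᵥ* U) j, -(x ᵥ* U) i, by simp [h], by ring⟩
  set y : n → ℂ := Pi.single i a + Pi.single j b with hy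
  have hxz : x ⬝ᵥ (U *ᵥ y) = 0 := by
    rw [Matrix.dotProduct_mulVec, hy, dotProduct_add, dotProduct_single, dotProduct_single]
    linear_combination h0
  have hle := hx _ hxz
  rw [hA.re_dotProduct_mulVec_eq_sum, Matrix.mulVec_mulVec, ← hU, hUU, Matrix.one_mulVec] at hle
  have hyi : y i = a := by simp [hy, hij]
  have hyj : y j = b := by simp [hy, Ne.symm hij]
  have hnn : ∀ k ∈ Finset.univ, 0 ≤ hA.eigenvalues k * Complex.normSq (y k) := by
    intro k _
    by_cases hki : k = i
    · subst hki; exact mul_nonneg hi.le (Complex.normSq_nonneg _)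
    by_cases hkj : k = j
    · subst hkj; exact mul_nonneg hj.le (Complex.normSq_nonneg _)
    simp [hy, hki, hkj]
  have hz := (Finset.sum_eq_zero_iff_of_nonneg hnn).1 (le_antisymm hle (Finset.sum_nonneg hnn))
  have hzi := hz i (Finset.mem_univ _)
  have hzj := hz j (Finset.mem_univ _)
  rw [hyi, mul_eq_zero, Complex.normSq_eq_zero] at hzi
  rw [hyj, mul_eq_zero, Complex.normSq_eq_zero] at hzj
  rcases hab with h | h
  · exact h (hzi.resolve_left hi.ne')
  · exact h (hzj.resolve_left hj.ne')

open scoped Matrix in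
/-- If a Hermitian matrix has at most one positive eigenvalue, its form is nonpositive at some
nontrivial combination of any two vectors. -/
theorem Matrix.IsHermitian.exists_re_dotProduct_mulVec_nonpos {n : Type*} [Fintype n]
    [DecidableEq n] {A : Matrix n n ℂ} (hA : A.IsHermitian)
    (hcard : (Finset.univ.filter fun i => 0 < hA.eigenvalues i).card ≤ 1) (w₁ w₂ : n → ℂ) :
    ∃ a b : ℂ, (a ≠ 0 ∨ b ≠ 0) ∧
      (star (a • w₁ + b • w₂) ⬝ᵥ (A *ᵥ (a • w₁ + b • w₂))).re ≤ 0 := by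
  rcases isEmpty_or_nonempty n with _ | _
  · exact ⟨1, 1, by simp, by simp [dotProduct]⟩
  obtain ⟨i, hi⟩ := Finset.card_le_one_iff_subset_singleton.1 hcard
  set U : Matrix n n ℂ := hA.eigenvectorUnitary.1 with hU
  -- Choose the combination with no component along eigenvector `i`, the only one whose eigenvalue
  -- may be positive.
  obtain ⟨a, b, hab, h0⟩ : ∃ a b : ℂ, (a ≠ 0 ∨ b ≠ 0) ∧
      a * (star U *ᵥ w₁) i + b * (star U *ᵥ w₂) i = 0 := by
    by_cases h : (star U *ᵥ w₁) i = 0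
    · exact ⟨1, 0, by simp, by simp [h]⟩
    · exact ⟨(star U *ᵥ w₂) i, -(star U *ᵥ w₁) i, by simp [h], by ring⟩
  refine ⟨a, b, hab, ?_⟩
  rw [hA.re_dotProduct_mulVec_eq_sum, ← hU]
  refine Finset.sum_nonpos fun k _ => ?_
  by_cases hk : k = i
  · have : (star U *ᵥ (a • w₁ + b • w₂)) k = 0 := by
      rw [hk, Matrix.mulVec_add, Matrix.mulVec_smul, Matrix.mulVec_smul]
      simpa using h0
    simp [this]
  · refine mul_nonpos_of_nonpos_of_nonneg ?_ (Complex.normSq_nonneg _)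
    by_contra hpos
    exact hk (by simpa using hi (Finset.mem_filter.2 ⟨Finset.mem_univ k, not_le.1 hpos⟩))

/-- A nonzero Hermitian matrix of trace zero has a positive eigenvalue. -/
theorem Matrix.IsHermitian.one_le_card_pos_eigenvalues {n : Type*} [Fintype n] [DecidableEq n]
    {A : Matrix n n ℂ} (hA : A.IsHermitian) (htr : A.trace = 0) (hne : A ≠ 0) :
    1 ≤ (Finset.univ.filter fun i => 0 < hA.eigenvalues i).card := by
  rw [Finset.one_le_card]
  by_contra h
  rw [Finset.not_nonempty_iff_eq_empty, Finset.filter_eq_empty_iff] at h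
  have hsum : ∑ i, hA.eigenvalues i = 0 := by
    have := hA.trace_eq_sum_eigenvalues
    rw [htr] at this
    apply Complex.ofReal_injective
    rw [Complex.ofReal_sum, Complex.ofReal_zero]
    exact this.symm
  have hz := (Finset.sum_eq_zero_iff_of_nonpos fun i hi => not_lt.1 (h hi)).1 hsum
  exact hne (hA.eigenvalues_eq_zero_iff.1 (funext fun i => hz i (Finset.mem_univ i)))

/-! ### Sides of a bipartite graph -/

/-- A bipartite graph has a two-valued side function that separates adjacent vertices. -/
theorem SimpleGraph.IsBipartite.exists_side {V : Type*} {G : SimpleGraph V}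
    (h : G.IsBipartite) : ∃ s : V → Bool, ∀ u v, G.Adj u v → s u ≠ s v := by
  obtain ⟨C⟩ := h
  refine ⟨fun v => decide (C v = 0), fun u v huv => ?_⟩
  have key : ∀ x y : Fin 2, x ≠ y → decide (x = 0) ≠ decide (y = 0) := by decide
  exact key _ _ (C.valid huv)

/-- Trades the isomorphism for a colouring of `V` itself; surjectivity of `s` encodes `p, q ≥ 1`. -/
theorem SimpleGraph.isCompleteBipartiteGraph_iff_exists_side {V : Type*} [Fintype V]
    {G : SimpleGraph V} : G.IsCompleteBipartiteGraph ↔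
      ∃ s : V → Bool, Function.Surjective s ∧ ∀ u v, G.Adj u v ↔ s u ≠ s v := by
  constructor
  · rintro ⟨p, q, hp, hq, ⟨f⟩⟩
    refine ⟨fun v => (f v).isLeft, ?_, fun u v => ?_⟩
    · rintro (_ | _)
      · exact ⟨f.symm (Sum.inr ⟨0, hq⟩), by simp⟩
      · exact ⟨f.symm (Sum.inl ⟨0, hp⟩), by simp⟩
    · rw [← f.map_adj_iff]
      rcases hu : f u with _ | _ <;> rcases hv : f v with _ | _ <;> simp [hu, hv]
  · rintro ⟨s, hs, hadj⟩
    let eT := Fintype.equivFin {v // s v = true}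
    let eF := Fintype.equivFin {v // ¬ s v = true}
    obtain ⟨a, ha⟩ := hs true
    obtain ⟨b, hb⟩ := hs false
    have : Nonempty {v // s v = true} := ⟨⟨a, ha⟩⟩
    have : Nonempty {v // ¬ s v = true} := ⟨⟨b, by simp [hb]⟩⟩
    refine ⟨_, _, Fintype.card_pos (α := {v // s v = true}),
      Fintype.card_pos (α := {v // ¬ s v = true}), ⟨?_⟩⟩
    refine RelIso.trans (RelIso.symm ⟨Equiv.sumCompl fun v => s v = true, ?_⟩)
      (completeBipartiteGraphCongr eT eF)
    rintro (⟨x, hx⟩ | ⟨x, hx⟩) (⟨y, hy⟩ | ⟨y, hy⟩) <;> simp_all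

/-! ### Block minors of the adjacency matrix -/

namespace TGainGraph

variable {V : Type*} {G : SimpleGraph V}

theorem adjMatrix_of_adj (Φ : TGainGraph G) {u v : V} (h : G.Adj u v) :
    Φ.adjMatrix u v = Φ.gain ⟨(u, v), h⟩ := by
  simp [adjMatrix, h]

theorem adjMatrix_of_not_adj (Φ : TGainGraph G) {u v : V} (h : ¬ G.Adj u v) :
    Φ.adjMatrix u v = 0 := by
  simp [adjMatrix, h]

theorem adjMatrix_eq_zero_iff (Φ : TGainGraph G) {u v : V} :
    Φ.adjMatrix u v = 0 ↔ ¬ G.Adj u v := by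
  refine ⟨fun h hadj => ?_, Φ.adjMatrix_of_not_adj⟩
  rw [Φ.adjMatrix_of_adj hadj] at h
  exact Circle.coe_ne_zero _ h

theorem star_adjMatrix_apply (Φ : TGainGraph G) (u v : V) :
    star (Φ.adjMatrix u v) = Φ.adjMatrix v u :=
  Φ.adjMatrix_isHermitian.apply v u

theorem adjMatrix_mul_symm (Φ : TGainGraph G) {u v : V} (h : G.Adj u v) :
    Φ.adjMatrix u v * Φ.adjMatrix v u = 1 := by
  rw [← Φ.star_adjMatrix_apply u v, Φ.adjMatrix_of_adj h]
  simp [Complex.mul_conj]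

/-- The oriented edges between the two sides satisfy the exchange rule saying that all `2 × 2`
minors of the off-diagonal block of the adjacency matrix vanish. -/
def BlockMinorsVanish (Φ : TGainGraph G) (s : V → Bool) : Prop :=
  ∀ a a' b b', s a = true → s a' = true → s b = false → s b' = false →
    Φ.adjMatrix a b * Φ.adjMatrix a' b' = Φ.adjMatrix a b' * Φ.adjMatrix a' b

/-- If the block minors vanish, a connected bipartite gain graph is complete bipartite. -/
theorem adj_iff_of_blockMinorsVanish (Φ : TGainGraph G) {s : V → Bool} [Nontrivial V]
    (hconn : G.Connected) (hs : ∀ u v, G.Adj u v → s u ≠ s v) (h : Φ.BlockMinorsVanish s)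
    (u v : V) : G.Adj u v ↔ s u ≠ s v := by
  -- If `a`, `b` were not adjacent, neighbours `b'` of `a` and `a'` of `b` would give a minor with
  -- one zero product and one nonzero product.
  have key : ∀ a b, s a = true → s b = false → G.Adj a b := by
    intro a b ha hb
    obtain ⟨b', hab'⟩ := hconn.preconnected.exists_adj_of_nontrivial a
    obtain ⟨a', hba'⟩ := hconn.preconnected.exists_adj_of_nontrivial b
    have hb' : s b' = false := by have := hs _ _ hab'; simp_all
    have ha' : s a' = true := by have := hs _ _ hba'; simp_all
    have hm := h a a' b b' ha ha' hb hb'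
    by_contra hno
    rw [Φ.adjMatrix_of_not_adj hno, zero_mul, eq_comm, mul_eq_zero, Φ.adjMatrix_eq_zero_iff,
      Φ.adjMatrix_eq_zero_iff] at hm
    exact hm.elim (fun k => k hab') fun k => k hba'.symm
  refine ⟨hs u v, fun huv => ?_⟩
  cases hu : s u
  · exact (key v u (by simp_all) hu).symm
  · exact key u v hu (by simp_all)

open scoped Matrix in
/-- For a vector `w` living on one side, the Hermitian form at `w + A w` is `2 ‖A w‖²`. -/
theorem dotProduct_mulVec_add_mulVec [Fintype V] (Φ : TGainGraph G) {s : V → Bool}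
    (hs : ∀ u v, G.Adj u v → s u ≠ s v) {w : V → ℂ} (hw : ∀ u, s u = true → w u = 0) :
    star (w + Φ.adjMatrix *ᵥ w) ⬝ᵥ (Φ.adjMatrix *ᵥ (w + Φ.adjMatrix *ᵥ w)) =
      2 * (star (Φ.adjMatrix *ᵥ w) ⬝ᵥ (Φ.adjMatrix *ᵥ w)) := by
  set A := Φ.adjMatrix with hA
  have hflip : ∀ (c : Bool) (x : V → ℂ), (∀ u, s u = c → x u = 0) →
      ∀ u, s u = !c → (A *ᵥ x) u = 0 := by
    intro c x hx u hu
    refine Finset.sum_eq_zero fun v _ => ?_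
    change A u v * x v = 0
    by_cases huv : G.Adj u v
    · have hne := hs u v huv
      rw [hx v (by cases c <;> simp_all), mul_zero]
    · rw [hA, Φ.adjMatrix_of_not_adj huv, zero_mul]
  have hw1 := hflip true w hw
  have hw2 := hflip false _ hw1
  have h1 : star w ⬝ᵥ (A *ᵥ w) = 0 := by
    refine Finset.sum_eq_zero fun u _ => ?_
    cases hu : s u
    · rw [hw1 u hu, mul_zero]
    · simp [hw u hu]
  have h2 : star (A *ᵥ w) ⬝ᵥ (A *ᵥ (A *ᵥ w)) = 0 := by
    refine Finset.sum_eq_zero fun u _ => ?_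
    cases hu : s u
    · simp [hw1 u hu]
    · rw [hw2 u hu, mul_zero]
  have h3 : star w ⬝ᵥ (A *ᵥ (A *ᵥ w)) = star (A *ᵥ w) ⬝ᵥ (A *ᵥ w) := by
    rw [Matrix.star_mulVec, Φ.adjMatrix_isHermitian.eq, ← Matrix.dotProduct_mulVec]
  rw [Matrix.mulVec_add, star_add, add_dotProduct, dotProduct_add, dotProduct_add, h1, h2, h3]
  ring

section Fintype

variable [Fintype V] [DecidableEq V]

theorem numPosEigenvalues_pos (Φ : TGainGraph G) {u v : V} (h : G.Adj u v) :
    1 ≤ Φ.numPosEigenvalues := by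
  refine Φ.adjMatrix_isHermitian.one_le_card_pos_eigenvalues ?_ fun h0 => ?_
  · exact Finset.sum_eq_zero fun i _ => Φ.adjMatrix_of_not_adj (G.irrefl)
  · exact Φ.adjMatrix_eq_zero_iff.1 (congrFun (congrFun h0 u) v) h

/-- Excludes the one-vertex graph, which is connected and bipartite but has no edge. -/
theorem exists_adj_of_numPosEigenvalues (Φ : TGainGraph G) (h : Φ.numPosEigenvalues = 1) :
    ∃ u v, G.Adj u v := by
  by_contra! hno
  have h0 : Φ.adjMatrix = 0 := by
    ext u v
    exact Φ.adjMatrix_of_not_adj (hno u v)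
  have he := Φ.adjMatrix_isHermitian.eigenvalues_eq_zero_iff.2 h0
  simp [numPosEigenvalues, he] at h

open scoped Matrix ComplexOrder in
theorem blockMinorsVanish_of_numPosEigenvalues (Φ : TGainGraph G) {s : V → Bool}
    (hs : ∀ u v, G.Adj u v → s u ≠ s v) (h : Φ.numPosEigenvalues = 1) :
    Φ.BlockMinorsVanish s := by
  intro a a' b b' _ _ hb hb'
  set A := Φ.adjMatrix with hA
  obtain ⟨x, y, hxy, hle⟩ := Φ.adjMatrix_isHermitian.exists_re_dotProduct_mulVec_nonpos h.le
    (Pi.single b 1 + A *ᵥ Pi.single b 1) (Pi.single b' 1 + A *ᵥ Pi.single b' 1)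
  set w : V → ℂ := x • Pi.single b 1 + y • Pi.single b' 1 with hw
  have hcomb : x • (Pi.single b 1 + A *ᵥ Pi.single b 1) +
      y • (Pi.single b' 1 + A *ᵥ Pi.single b' 1) = w + A *ᵥ w := by
    rw [hw, Matrix.mulVec_add, Matrix.mulVec_smul, Matrix.mulVec_smul, smul_add, smul_add]
    abel
  rw [hcomb, Φ.dotProduct_mulVec_add_mulVec hs (w := w)] at hle
  · have hnn : 0 ≤ star (A *ᵥ w) ⬝ᵥ (A *ᵥ w) := dotProduct_star_self_nonneg _
    have hre := (Complex.le_def.1 hnn).1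
    have him := (Complex.le_def.1 hnn).2
    have hzero : star (A *ᵥ w) ⬝ᵥ (A *ᵥ w) = 0 := by
      apply Complex.ext
      · have : (2 * (star (A *ᵥ w) ⬝ᵥ (A *ᵥ w))).re = 2 * (star (A *ᵥ w) ⬝ᵥ (A *ᵥ w)).re := by
          simp
        rw [← hA, this] at hle
        simp only [Complex.zero_re] at hre ⊢
        linarith
      · simpa using him.symm
    rw [dotProduct_star_self_eq_zero] at hzero
    have hrow : ∀ u, x * A u b + y * A u b' = 0 := by
      intro u
      have := congrFun hzero u
      rw [hw, Matrix.mulVec_add, Matrix.mulVec_smul, Matrix.mulVec_smul] at this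
      simpa using this
    have e1 := hrow a
    have e2 := hrow a'
    rcases hxy with hx | hy
    · refine mul_left_cancel₀ hx ?_
      linear_combination A a' b' * e1 - A a b' * e2
    · refine mul_left_cancel₀ hy ?_
      linear_combination A a b * e2 - A a' b * e1
  · intro u hu
    have h1 : u ≠ b := by rintro rfl; simp [hb] at hu
    have h2 : u ≠ b' := by rintro rfl; simp [hb'] at hu
    simp [hw, h1, h2]

/-! ### Switching equivalence and the eigenvalue count -/

/-- Entrywise form of switching equivalence to the all-one gain graph. -/
theorem switchingEquivalent_allOne_iff (Φ : TGainGraph G) :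
    Φ.SwitchingEquivalent (allOne G) ↔ ∃ d : V → ℂ, (∀ v, d v * star (d v) = 1) ∧
      ∀ u v, G.Adj u v → Φ.adjMatrix u v = star (d u) * d v := by
  have hun : ∀ d : V → ℂ, Matrix.diagonal d ∈ Matrix.unitaryGroup V ℂ ↔
      ∀ v, d v * star (d v) = 1 := by
    intro d
    rw [Matrix.mem_unitaryGroup_iff, Matrix.star_eq_conjTranspose, Matrix.diagonal_conjTranspose,
      Matrix.diagonal_mul_diagonal, ← Matrix.diagonal_one, Matrix.diagonal_eq_diagonal_iff]
    rfl
  refine exists_congr fun d => ?_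
  rw [hun]
  refine and_congr_right fun hd => ?_
  rw [← Matrix.ext_iff]
  refine forall_congr' fun u => forall_congr' fun v => ?_
  rw [Matrix.diagonal_conjTranspose, Matrix.mul_diagonal, Matrix.diagonal_mul, Pi.star_apply]
  by_cases huv : G.Adj u v
  · rw [adjMatrix_of_adj _ huv]
    simp only [allOne, Circle.coe_one, huv, true_imp_iff]
    constructor
    · intro h
      linear_combination (- star (d u) * d v) * h - Φ.adjMatrix u v * hd u -
        d u * star (d u) * Φ.adjMatrix u v * hd v
    · intro h
      linear_combination (-d u * star (d v)) * h - hd u - d u * star (d u) * hd v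
  · simp [adjMatrix_of_not_adj _ huv, huv]

theorem switchingEquivalent_allOne_of_blockMinorsVanish (Φ : TGainGraph G) {s : V → Bool}
    (hsurj : Function.Surjective s) (hadj : ∀ u v, G.Adj u v ↔ s u ≠ s v)
    (h : Φ.BlockMinorsVanish s) : Φ.SwitchingEquivalent (allOne G) := by
  obtain ⟨a₀, ha₀⟩ := hsurj true
  obtain ⟨b₀, hb₀⟩ := hsurj false
  have hTF : ∀ a b, s a = true → s b = false → G.Adj a b := fun a b ha hb =>
    (hadj a b).2 (by simp [ha, hb])
  have h00 := Φ.adjMatrix_mul_symm (hTF a₀ b₀ ha₀ hb₀)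
  rw [switchingEquivalent_allOne_iff]
  -- `d v` is the gain from `a₀` to `v` in the spanning double star centred at `a₀` and `b₀`; the
  -- minors through `a₀`, `b₀` handle the remaining edges.
  let d : V → ℂ := fun v =>
    if s v = true then Φ.adjMatrix b₀ v * Φ.adjMatrix a₀ b₀ else Φ.adjMatrix a₀ v
  have hdT : ∀ a, s a = true → d a = Φ.adjMatrix b₀ a * Φ.adjMatrix a₀ b₀ := fun a ha => by
    simp [d, ha]
  have hdF : ∀ b, s b = false → d b = Φ.adjMatrix a₀ b := fun b hb => by simp [d, hb]
  have hd : ∀ a b, s a = true → s b = false → Φ.adjMatrix a b = star (d a) * d b := by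
    intro a b ha hb
    rw [hdT a ha, hdF b hb, star_mul', star_adjMatrix_apply, star_adjMatrix_apply]
    have hm := h a a₀ b b₀ ha ha₀ hb hb₀
    linear_combination Φ.adjMatrix b₀ a₀ * hm - Φ.adjMatrix a b * h00
  refine ⟨d, fun v => ?_, fun u v huv => ?_⟩
  · cases hv : s v
    · rw [hdF v hv, star_adjMatrix_apply, Φ.adjMatrix_mul_symm (hTF a₀ v ha₀ hv)]
    · rw [hdT v hv, star_mul', star_adjMatrix_apply, star_adjMatrix_apply]
      linear_combination h00 + Φ.adjMatrix a₀ b₀ * Φ.adjMatrix b₀ a₀ *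
        Φ.adjMatrix_mul_symm (hTF v b₀ hv hb₀)
  · have hne := (hadj u v).1 huv
    cases hu : s u
    · rw [← star_adjMatrix_apply, hd v u (by simpa [hu] using hne) hu, star_mul', star_star, mul_comm]
    · exact hd u v hu (by simpa [hu] using hne)

open scoped Matrix in
theorem numPosEigenvalues_eq_one_of_switchingEquivalent (Φ : TGainGraph G) {s : V → Bool}
    (hsurj : Function.Surjective s) (hadj : ∀ u v, G.Adj u v ↔ s u ≠ s v)
    (h : Φ.SwitchingEquivalent (allOne G)) : Φ.numPosEigenvalues = 1 := by
  obtain ⟨d, -, hA⟩ := Φ.switchingEquivalent_allOne_iff.1 h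
  obtain ⟨a₀, ha₀⟩ := hsurj true
  obtain ⟨b₀, hb₀⟩ := hsurj false
  refine le_antisymm (Φ.adjMatrix_isHermitian.card_pos_eigenvalues_le_one d fun z hz => ?_)
    (Φ.numPosEigenvalues_pos ((hadj a₀ b₀).2 (by simp [ha₀, hb₀])))
  -- On the hyperplane the two sides contribute opposite sums `S` and `-S`, so the form, twice the
  -- real part of their Hermitian product, is `-2 |S|²`.
  set S : ℂ := ∑ v, if s v = true then d v * z v else 0 with hS
  have hSF : ∑ v, (if s v = true then 0 else d v * z v) = -S := by
    rw [eq_neg_iff_add_eq_zero, hS, ← Finset.sum_add_distrib]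
    refine (Finset.sum_congr rfl fun v _ => ?_).trans hz
    split_ifs <;> simp
  have hAz : ∀ u, (Φ.adjMatrix *ᵥ z) u = star (d u) * (if s u = true then -S else S) := by
    intro u
    have hentry : ∀ v, Φ.adjMatrix u v * z v =
        star (d u) * (if s v = s u then 0 else d v * z v) := by
      intro v
      by_cases huv : G.Adj u v
      · rw [hA u v huv, if_neg fun k => (hadj u v).1 huv k.symm, mul_assoc]
      · have : s v = s u := by
          by_contra k
          exact huv ((hadj u v).2 (Ne.symm k))
        rw [Φ.adjMatrix_of_not_adj huv, if_pos this, zero_mul, mul_zero]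
    rw [Matrix.mulVec, dotProduct, Finset.sum_congr rfl fun v _ => hentry v, ← Finset.mul_sum]
    congr 1
    cases hu : s u
    · simp only [Bool.false_eq_true, if_false, hS]
      refine Finset.sum_congr rfl fun v _ => ?_
      cases s v <;> simp
    · rw [if_pos rfl, hSF]
  have hform : star z ⬝ᵥ (Φ.adjMatrix *ᵥ z) = -2 * (S * star S) := by
    have hterm : ∀ v, star (z v) * (Φ.adjMatrix *ᵥ z) v =
        S * star (if s v = true then 0 else d v * z v) -
          S * star (if s v = true then d v * z v else 0) := by
      intro v
      rw [hAz v]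
      split_ifs <;> simp <;> ring
    refine (Finset.sum_congr rfl fun v _ => hterm v).trans ?_
    rw [Finset.sum_sub_distrib,
      ← Finset.mul_sum, ← Finset.mul_sum, ← star_sum, ← star_sum, hSF, ← hS, star_neg]
    ring
  rw [hform]
  simp [Complex.mul_conj]
  exact Complex.normSq_nonneg _

end Fintype

/-! ### Balance -/

/-- If the gains are a coboundary, the gain of a walk depends only on its endpoints. -/
theorem coe_walkGain_eq (Φ : TGainGraph G) {d : V → ℂ} (hd : ∀ v, d v * star (d v) = 1)
    (hA : ∀ u v, G.Adj u v → Φ.adjMatrix u v = star (d u) * d v) {u v : V} (p : G.Walk u v) :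
    (Φ.walkGain p : ℂ) = star (d u) * d v := by
  induction p with
  | nil => rename_i u; simpa [walkGain, mul_comm] using (hd u).symm
  | cons hadj p ih =>
    rename_i u v w
    have h1 : Φ.walkGain (SimpleGraph.Walk.cons hadj p) =
        Φ.gain ⟨(u, v), hadj⟩ * Φ.walkGain p := by simp [walkGain]
    rw [h1, Circle.coe_mul, ih, ← Φ.adjMatrix_of_adj hadj, hA u v hadj]
    linear_combination star (d u) * d w * hd v

theorem isBalanced_of_switchingEquivalent_allOne [Fintype V] [DecidableEq V] (Φ : TGainGraph G)
    (h : Φ.SwitchingEquivalent (allOne G)) : Φ.IsBalanced := by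
  obtain ⟨d, hd, hA⟩ := Φ.switchingEquivalent_allOne_iff.1 h
  intro v c _
  have := Φ.coe_walkGain_eq hd hA c
  rw [mul_comm, hd v] at this
  exact Circle.ext (by rw [this, Circle.coe_one])

/-- Balance of the `4`-cycles of a complete bipartite graph makes the block minors vanish. -/
theorem IsBalanced.blockMinorsVanish {Φ : TGainGraph G} (h : Φ.IsBalanced) {s : V → Bool}
    (hadj : ∀ u v, G.Adj u v ↔ s u ≠ s v) : Φ.BlockMinorsVanish s := by
  intro a a' b b' ha ha' hb hb'
  by_cases haa : a = a'
  · subst haa; ring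
  by_cases hbb : b = b'
  · subst hbb; ring
  have h1 : G.Adj a b := (hadj _ _).2 (by simp [ha, hb])
  have h2 : G.Adj b a' := (hadj _ _).2 (by simp [ha', hb])
  have h3 : G.Adj a' b' := (hadj _ _).2 (by simp [ha', hb'])
  have h4 : G.Adj b' a := (hadj _ _).2 (by simp [ha, hb'])
  have hc := h a (.cons h1 (.cons h2 (.cons h3 (.cons h4 .nil)))) (by
    rw [SimpleGraph.Walk.cons_isCycle_iff]
    have := h1.ne; have := h2.ne; have := h3.ne; have := h4.ne
    constructor
    · simp [SimpleGraph.Walk.isPath_def]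
      grind
    · simp
      grind)
  -- Moving the edges `b a'` and `b' a` to the other side inverts them, turning the cycle gain into
  -- the minor identity.
  have hg : Φ.adjMatrix a b * (Φ.adjMatrix b a' * (Φ.adjMatrix a' b' * Φ.adjMatrix b' a)) = 1 := by
    rw [Φ.adjMatrix_of_adj h1, Φ.adjMatrix_of_adj h2, Φ.adjMatrix_of_adj h3,
      Φ.adjMatrix_of_adj h4]
    have := congrArg (fun x : Circle => (x : ℂ)) hc
    simpa [walkGain] using this
  have e2 := Φ.adjMatrix_mul_symm h2
  have e4 := Φ.adjMatrix_mul_symm h4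
  linear_combination Φ.adjMatrix a b' * Φ.adjMatrix a' b * hg -
    Φ.adjMatrix a b * Φ.adjMatrix a' b' * (Φ.adjMatrix b' a * Φ.adjMatrix a b') * e2 -
    Φ.adjMatrix a b * Φ.adjMatrix a' b' * e4

end TGainGraph

theorem mainTheorem6 {V : Type*} [Fintype V] [DecidableEq V] (G : SimpleGraph V)
    (hconn : G.Connected) (hbip : G.IsBipartite) (Φ : TGainGraph G) :
    (Φ.numPosEigenvalues = 1 ↔ G.IsCompleteBipartiteGraph ∧ Φ.IsBalanced) ∧
    (Φ.numPosEigenvalues = 1 ↔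
      G.IsCompleteBipartiteGraph ∧ Φ.SwitchingEquivalent (TGainGraph.allOne G)) := by
  have h13 : Φ.numPosEigenvalues = 1 →
      G.IsCompleteBipartiteGraph ∧ Φ.SwitchingEquivalent (TGainGraph.allOne G) := by
    intro h
    obtain ⟨s, hs⟩ := hbip.exists_side
    obtain ⟨u, v, huv⟩ := Φ.exists_adj_of_numPosEigenvalues h
    have : Nontrivial V := ⟨u, v, huv.ne⟩
    have hm := Φ.blockMinorsVanish_of_numPosEigenvalues hs h
    have hadj := Φ.adj_iff_of_blockMinorsVanish hconn hs hm
    have hne := hs u v huv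
    have hsurj : Function.Surjective s := by
      intro c
      by_cases hc : s u = c
      · exact ⟨u, hc⟩
      · exact ⟨v, by cases c <;> simp_all⟩
    exact ⟨SimpleGraph.isCompleteBipartiteGraph_iff_exists_side.2 ⟨s, hsurj, hadj⟩,
      Φ.switchingEquivalent_allOne_of_blockMinorsVanish hsurj hadj hm⟩
  have h31 : G.IsCompleteBipartiteGraph → Φ.SwitchingEquivalent (TGainGraph.allOne G) →
      Φ.numPosEigenvalues = 1 := by
    intro hG h
    obtain ⟨s, hsurj, hadj⟩ := SimpleGraph.isCompleteBipartiteGraph_iff_exists_side.1 hG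
    exact Φ.numPosEigenvalues_eq_one_of_switchingEquivalent hsurj hadj h
  refine ⟨⟨fun h => ⟨(h13 h).1, Φ.isBalanced_of_switchingEquivalent_allOne (h13 h).2⟩, ?_⟩,
    ⟨h13, fun h => h31 h.1 h.2⟩⟩
  rintro ⟨hG, hb⟩
  obtain ⟨s, hsurj, hadj⟩ := SimpleGraph.isCompleteBipartiteGraph_iff_exists_side.1 hG
  exact h31 hG (Φ.switchingEquivalent_allOne_of_blockMinorsVanish hsurj hadj
    (hb.blockMinorsVanish hadj))
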